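/- **Setting.** Let $K,m\ge 1$. A $(K,m)$-uplifting bandit consists of a baseline probability distribution $P^0$ on $\mathbb R^m$, probability distributions $P^1,\dots,P^K$ on $\mathbb R^m$ (one per action), and sets $V^1,\dots,V^K\subseteq\{1,\dots,m\}$ of affected variables, where $V^a$ is such that $P^a$ and $P^0$ have the same joint marginal distribution on the variables outside $V^a$, and no proper subset of $V^a$ has this property. It is $1$-sub-Gaussian if for every $a\in\{0,\dots,K\}$ and every $i$, with $x\sim P^a$ and $\xi=x_i-\mathbb E[x_i]$, one has $\mathbb E[e^{s\xi}]\le e^{s^2/2}$ for all $s\in\mathbb R$. In each round $t$ the learner chooses an action $a_t\in\{1,\dots,K\}$ and a payoff vector $x_t\sim P^{a_t}$ is drawn, conditionally on $a_t$ independently of the past; the learner observes $x_t$, and the reward is $\sum_i x_{t,i}$. Let $r^a=\mathbb E_{x\sim P^a}[\sum_i x_i]$ be the expected reward of action $a$, let $\max_b r^b-r^a$ be its suboptimality gap, and let $\mathrm{Reg}_T=\sum_{t=1}^T(\max_b r^b-r^{a_t})$ be the regret. An algorithm $\pi$ chooses each action, possibly at random, as a (measurable) function of the past actions and observations and of its prior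 knowledge, which consists at most of $P^0$ and $(V^a)_{1\le a\le K}$ (besides the fact that the bandit is $1$-sub-Gaussian). It is consistent over the $1$-sub-Gaussian uplifting bandits if on every $1$-sub-Gaussian $(K,m)$-uplifting bandit $\mathbb E[\mathrm{Reg}_T]=o(T^p)$ as $T\to\infty$ for every $p>0$. **Proposition.** Let $\pi$ be such a consistent algorithm. Let $L^a\in\{1,\dots,m\}$ and $\Delta^a\ge 0$ for $1\le a\le K$, with $\Delta^1=0$. Assume that one of the following holds: (a) $L^a=m$ for all $a$; (b) only the reward is observed, that is, the choices of $\pi$ depend on the past payoff vectors only through the past rewards; (c) $\pi$ makes no use of prior knowledge about the expected payoffs of the actions, that is, its choices do not depend on $(V^a)_{1\le a\le K}$ (they may depend on $P^0$). Then there is a $1$-sub-Gaussian $(K,m)$-uplifting bandit in which every action $a$ has suboptimality gap $\Delta^a$ and $|V^a|=L^a$, and on which $\pi$ satisfies $$\liminf_{T\to\infty}\frac{\mathbb E[\mathrm{Reg}_T]}{\log T}\ \ge\ \sum_{a:\,\Delta^a>0}\frac{2m^2}{\Delta^a}$$ (the left-hand side may be $+\infty$). -/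

import Mathlib

open MeasureTheory ProbabilityTheory Filter Asymptotics
open scoped NNReal

namespace Uplift

/-- The laws `P` and `Q` on `ℝ^m` have the same (joint) marginal distribution on the variables
outside `S`. -/
def AgreeOff {m : ℕ} (P Q : ProbabilityMeasure (Fin m → ℝ)) (S : Finset (Fin m)) : Prop :=
  (P : Measure (Fin m → ℝ)).map (fun x (i : {i : Fin m // i ∉ S}) => x i.1) =
    (Q : Measure (Fin m → ℝ)).map (fun x (i : {i : Fin m // i ∉ S}) => x i.1)

/-- A `(K, m)`-uplifting bandit: the baseline law, the law of the payoff vector of every action,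
and the set of variables that every action affects. An action leaves the joint law of the
variables outside its affected set as in the baseline, and no proper subset of the affected set
has that property (every listed variable is really needed). -/
structure UpliftingBandit (K m : ℕ) where
  baseline : ProbabilityMeasure (Fin m → ℝ)
  arm : Fin K → ProbabilityMeasure (Fin m → ℝ)
  affected : Fin K → Finset (Fin m)
  affected_minimal : ∀ a, Minimal (AgreeOff (arm a) baseline) (affected a)

/-- Under the law `P` of the payoff vector, each noise variable `x i - E[x i]` is
1-sub-Gaussian: `E[exp (s (x i - E[x i]))] ≤ exp (s ^ 2 / 2)` for all real `s`, the expectation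
being finite. -/
def NoiseSubGaussian {m : ℕ} (P : ProbabilityMeasure (Fin m → ℝ)) : Prop :=
  ∀ i : Fin m, HasSubgaussianMGF
    (fun x : Fin m → ℝ => x i - ∫ y, y i ∂(P : Measure (Fin m → ℝ))) 1
    (P : Measure (Fin m → ℝ))

namespace UpliftingBandit

variable {K m : ℕ} (B : UpliftingBandit K m)

/-- The bandit is 1-sub-Gaussian: the noise of each variable is 1-sub-Gaussian, for the baseline
and for every action. -/
def IsSubGaussian : Prop :=
  NoiseSubGaussian B.baseline ∧ ∀ a, NoiseSubGaussian (B.arm a)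

/-- The expected reward of an action: the sum of the expected payoffs of the variables. -/
noncomputable def meanReward (a : Fin K) : ℝ :=
  ∑ i, ∫ x, x i ∂(B.arm a : Measure (Fin m → ℝ))

/-- The suboptimality gap of an action. -/
noncomputable def gap (a : Fin K) : ℝ :=
  (⨆ b, B.meanReward b) - B.meanReward a

/-- The law of the payoff vector, as a Markov kernel from actions. -/
noncomputable def payoffKernel : Kernel (Fin K) (Fin m → ℝ) :=
  Kernel.ofFunOfCountable fun a => (B.arm a : Measure (Fin m → ℝ))

instance : IsMarkovKernel B.payoffKernel :=
  ⟨fun a => inferInstanceAs (IsProbabilityMeasure (B.arm a : Measure (Fin m → ℝ)))⟩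

end UpliftingBandit

/-- What a learner has seen after `t` rounds: for every round, its action and the vector of all
payoffs. -/
abbrev History (K m t : ℕ) : Type := Fin t → Fin K × (Fin m → ℝ)

/-- A (possibly randomized) policy: the conditional law of the next action, given the history of
the first `t` rounds. -/
structure Policy (K m : ℕ) where
  next : (t : ℕ) → Kernel (History K m t) (Fin K)
  markov : ∀ t, IsMarkovKernel (next t)

/-- An algorithm whose prior knowledge about the bandit consists at most of the baseline law and
of the sets of affected variables. -/
abbrev Algorithm (K m : ℕ) : Type :=
  ProbabilityMeasure (Fin m → ℝ) → (Fin K → Finset (Fin m)) → Policy K m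

/-- The joint law of actions and payoffs over the first `t` rounds, when policy `π` interacts with
bandit `B`: given the past, the next action is drawn from `π`, and given also that action `a`, the
payoff vector is drawn from `B.arm a`. -/
noncomputable def historyLaw {K m : ℕ} (π : Policy K m) (B : UpliftingBandit K m) :
    (t : ℕ) → Measure (History K m t)
  | 0 => Measure.dirac Fin.elim0
  | t + 1 =>
    (historyLaw π B t ⊗ₘ (π.next t ⊗ₖ Kernel.prodMkLeft (History K m t) B.payoffKernel)).map
      fun p => Fin.snoc (α := fun _ => Fin K × (Fin m → ℝ)) p.1 p.2

theorem measurable_snoc {K m t : ℕ} :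
    Measurable fun p : History K m t × (Fin K × (Fin m → ℝ)) =>
      Fin.snoc (α := fun _ => Fin K × (Fin m → ℝ)) p.1 p.2 := by
  refine measurable_pi_iff.mpr fun i => ?_
  refine Fin.lastCases ?_ (fun j => ?_) i
  · simpa using measurable_snd
  · simp only [Fin.snoc_castSucc]
    exact (measurable_pi_apply j).comp measurable_fst

instance {K m : ℕ} (π : Policy K m) (B : UpliftingBandit K m) (t : ℕ) :
    IsProbabilityMeasure (historyLaw π B t) := by
  induction t with
  | zero => exact inferInstanceAs (IsProbabilityMeasure (Measure.dirac _))
  | succ t ih =>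
    have := π.markov t
    exact Measure.isProbabilityMeasure_map measurable_snoc.aemeasurable

/-- The expected regret of a policy after `T` rounds. -/
noncomputable def expectedRegret {K m : ℕ} (π : Policy K m) (B : UpliftingBandit K m) (T : ℕ) : ℝ :=
  ∫ h, ∑ t : Fin T, B.gap (h t).1 ∂(historyLaw π B T)

namespace Algorithm

variable {K m : ℕ} (π : Algorithm K m)

/-- The expected regret of an algorithm, which is told the baseline law and the affected sets of
the bandit that it faces. -/
noncomputable def regret (B : UpliftingBandit K m) (T : ℕ) : ℝ :=
  expectedRegret (π B.baseline B.affected) B T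

/-- Consistency over the 1-sub-Gaussian uplifting bandits: on each of them, the expected regret
is `o(T ^ p)` for every `p > 0`. -/
def Consistent : Prop :=
  ∀ B : UpliftingBandit K m, B.IsSubGaussian → ∀ p : ℝ, 0 < p →
    (fun T : ℕ => π.regret B T) =o[atTop] fun T : ℕ => (T : ℝ) ^ p

/-- Only the reward is observed: decisions depend on the past payoff vectors only through their
sums. -/
def UsesOnlyRewards : Prop :=
  ∀ P₀ V t (h h' : History K m t),
    (∀ s, (h s).1 = (h' s).1 ∧ ∑ i, (h s).2 i = ∑ i, (h' s).2 i) →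
      (π P₀ V).next t h = (π P₀ V).next t h'

/-- The algorithm makes no use of prior knowledge on the actions: of the two pieces of prior
knowledge available, baseline law and affected sets, it ignores the latter. -/
def IgnoresAffected : Prop :=
  ∀ P₀ V V', π P₀ V = π P₀ V'

end Algorithm

end Uplift

/-!
The lower bound is that of Lai and Robbins, for bandits whose variables all share one standard
Gaussian noise. Under action `a` the payoff vector is `(Z + v a i)ᵢ` with a single `Z ∼ N(0, 1)`,
and the baseline is `(Z)ᵢ`. Such a vector is 1-sub-Gaussian, the set affected by `a` is the support
of `v a`, and the reward has the largest possible standard deviation, `m`: rewards that differ by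
`Δ` on average cost a relative entropy of only `Δ² / (2 m²)`, which is where `2 m² / Δ` comes from.

The bandit `B` spreads positive expected rewards with gaps `Δ a` over sets `V a` of sizes `L a`.
For a suboptimal `a`, the alternative bandit `B'` raises all the means of `a` by the same amount
`c`, just enough to make it the best action by a margin `ε`. This is a translation of `Z`, so the
two laws of `a` are mutually absolutely continuous, with relative entropy `c² / 2`. The
translation may enlarge the affected set of `a`, and consistency of the algorithm on `B'`, when it
is still told `V`, is what the three alternative hypotheses provide
(`isLittleO_expectedRegret_raisedMeans`). When only rewards are observed, `B'` is exchanged for a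
third bandit, with affected sets `V` and the same reward laws as `B'`: its payoff laws may be
singular to those of `B`, but a policy that sees only rewards plays it exactly as it plays `B'`
(`expectedPulls_eq_of_rewards`).

The comparison of `B` and `B'` rests on the likelihood ratio of a history being the product of the
ratios of its rounds (`historyLaw_eq_withDensity`), on Wald's identity for its logarithm
(`integral_history_sum`), and on a Bretagnolle–Huber inequality (`exp_integral_sub_one_le`). If
`N` is the expected number of pulls of `a` in `B`, then
`exp (-N c² / 2 - 1) * (T / 2) ≤ Reg_B / Δ a + Reg_B' / ε`, and the right-hand side is `o(T ^ p)` for every `p > 0`, so that `N c² / 2` is at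
least about `log T`. Letting `ε` and `p` tend to zero and summing over `a` gives the claim.
-/

namespace Uplift

variable {K m : ℕ}

/-! ### The law of the history -/

/-- The history obtained by recording one more round, with its action and payoff vector. -/
abbrev History.snoc {t : ℕ} (h : History K m t) (p : Fin K × (Fin m → ℝ)) : History K m (t + 1) :=
  Fin.snoc (α := fun _ => Fin K × (Fin m → ℝ)) h p

theorem History.sum_snoc {M : Type*} [AddCommMonoid M] {t : ℕ} (h : History K m t)
    (p : Fin K × (Fin m → ℝ)) (g : Fin K × (Fin m → ℝ) → M) :
    ∑ s, g (h.snoc p s) = ∑ s, g (h s) + g p := by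
  simp [Fin.sum_univ_castSucc, History.snoc]

theorem lintegral_historyLaw_succ (ρ : Policy K m) (B : UpliftingBandit K m) (t : ℕ)
    {f : History K m (t + 1) → ENNReal} (hf : Measurable f) :
    ∫⁻ h, f h ∂historyLaw ρ B (t + 1) =
      ∫⁻ h, ∑ a, ρ.next t h {a} * ∫⁻ x, f (h.snoc (a, x)) ∂(B.arm a : Measure (Fin m → ℝ))
        ∂historyLaw ρ B t := by
  have := ρ.markov t
  have hfs : Measurable fun p : History K m t × (Fin K × (Fin m → ℝ)) =>
      f (Fin.snoc (α := fun _ => Fin K × (Fin m → ℝ)) p.1 p.2) := hf.comp measurable_snoc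
  rw [historyLaw, lintegral_map hf measurable_snoc, Measure.lintegral_compProd hfs]
  refine lintegral_congr fun h => ?_
  have hfh : Measurable fun p : Fin K × (Fin m → ℝ) =>
      f (Fin.snoc (α := fun _ => Fin K × (Fin m → ℝ)) h p) := hfs.comp measurable_prodMk_left
  rw [Kernel.lintegral_compProd _ _ _ hfh, lintegral_fintype]
  refine Finset.sum_congr rfl fun a _ => ?_
  rw [mul_comm]
  rfl

theorem measurable_action {t : ℕ} (s : Fin t) : Measurable fun h : History K m t => (h s).1 :=
  measurable_fst.comp (measurable_pi_apply s)

theorem measurable_history_sum {M : Type*} [MeasurableSpace M] [AddCommMonoid M]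
    [MeasurableAdd₂ M] {g : Fin K → (Fin m → ℝ) → M} (hg : ∀ a, Measurable (g a)) (t : ℕ) :
    Measurable fun h : History K m t => ∑ s, g (h s).1 (h s).2 := by
  have : Measurable fun p : Fin K × (Fin m → ℝ) => g p.1 p.2 :=
    measurable_from_prod_countable_right hg
  exact Finset.measurable_sum _ fun s _ => this.comp (measurable_pi_apply s)

/-- Change of measure: when every arm of `B'` has density `exp (g a)` with respect to the same arm
of `B`, the likelihood ratio of a history is the exponential of the sum of the `g`s along it. The
policy contributes the same factor to both laws. -/
theorem lintegral_historyLaw_of_withDensity (ρ : Policy K m) {B B' : UpliftingBandit K m}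
    {g : Fin K → (Fin m → ℝ) → ℝ} (hg : ∀ a, Measurable (g a))
    (hB : ∀ a, (B'.arm a : Measure (Fin m → ℝ)) =
      (B.arm a : Measure (Fin m → ℝ)).withDensity fun x => ENNReal.ofReal (Real.exp (g a x)))
    (t : ℕ) {f : History K m t → ENNReal} (hf : Measurable f) :
    ∫⁻ h, f h ∂historyLaw ρ B' t =
      ∫⁻ h, ENNReal.ofReal (Real.exp (∑ s, g (h s).1 (h s).2)) * f h ∂historyLaw ρ B t := by
  induction t with
  | zero => simp [historyLaw]
  | succ t ih =>
    have hsnoc : ∀ a, Measurable fun p : History K m t × (Fin m → ℝ) => p.1.snoc (a, p.2) :=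
      fun a => measurable_snoc.comp
        (measurable_fst.prodMk (measurable_const.prodMk measurable_snd))
    have hnext : ∀ a, Measurable fun h => ρ.next t h {a} :=
      fun a => Kernel.measurable_coe _ (measurableSet_singleton a)
    rw [lintegral_historyLaw_succ ρ B' t hf, ih, lintegral_historyLaw_succ ρ B t]
    · refine lintegral_congr fun h => ?_
      rw [Finset.mul_sum]
      refine Finset.sum_congr rfl fun a _ => ?_
      have hfx : Measurable fun x => f (h.snoc (a, x)) :=
        hf.comp ((hsnoc a).comp measurable_prodMk_left)
      have hgx : Measurable fun x => ENNReal.ofReal (Real.exp (g a x)) := by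
        have := hg a
        fun_prop
      rw [hB a, lintegral_withDensity_eq_lintegral_mul _ hgx hfx, mul_left_comm,
        ← lintegral_const_mul _ (hgx.mul hfx)]
      congr 1
      refine lintegral_congr fun x => ?_
      rw [h.sum_snoc (a, x) (fun p => g p.1 p.2), Real.exp_add,
        ENNReal.ofReal_mul (Real.exp_nonneg _), mul_assoc]
      rfl
    · have := measurable_history_sum hg (t + 1)
      fun_prop
    · refine Finset.measurable_sum _ fun a _ => (hnext a).mul ?_
      exact (hf.comp (hsnoc a)).lintegral_prod_right'

theorem map_init_historyLaw (ρ : Policy K m) (B : UpliftingBandit K m) (t : ℕ) :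
    (historyLaw ρ B (t + 1)).map (fun h s => h (Fin.castSucc s)) = historyLaw ρ B t := by
  have := ρ.markov t
  rw [historyLaw, Measure.map_map (by fun_prop) measurable_snoc]
  have hfst : (fun (h : History K m (t + 1)) (s : Fin t) => h (Fin.castSucc s)) ∘
      (fun p : History K m t × (Fin K × (Fin m → ℝ)) =>
        Fin.snoc (α := fun _ => Fin K × (Fin m → ℝ)) p.1 p.2) = Prod.fst := by
    funext p s
    simp
  rw [hfst]
  exact Measure.fst_compProd _ _

/-- In a round, the payoff vector is drawn from the arm that is played. -/
theorem map_last_historyLaw (ρ : Policy K m) (B : UpliftingBandit K m) (t : ℕ) :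
    (historyLaw ρ B (t + 1)).map (fun h => h (Fin.last t)) =
      (historyLaw ρ B (t + 1)).map (fun h => (h (Fin.last t)).1) ⊗ₘ B.payoffKernel := by
  refine Measure.ext_of_lintegral _ fun f hf => ?_
  have hl : Measurable fun a => ∫⁻ x, f (a, x) ∂B.payoffKernel a := measurable_of_countable _
  have : IsProbabilityMeasure
      ((historyLaw ρ B (t + 1)).map (fun h => (h (Fin.last t)).1)) :=
    Measure.isProbabilityMeasure_map (measurable_action _).aemeasurable
  have hlast : Measurable fun h : History K m (t + 1) =>
      ∫⁻ x, f ((h (Fin.last t)).1, x) ∂B.payoffKernel (h (Fin.last t)).1 :=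
    hl.comp (measurable_action _)
  rw [Measure.lintegral_compProd hf, lintegral_map hf (by fun_prop),
    lintegral_map hl (measurable_action _), lintegral_historyLaw_succ _ _ _ (by fun_prop),
    lintegral_historyLaw_succ _ _ _ hlast]
  refine lintegral_congr fun h => Finset.sum_congr rfl fun a _ => ?_
  simp only [History.snoc, Fin.snoc_last, lintegral_const, measure_univ, mul_one]
  rfl

/-! ### Expected numbers of pulls -/

/-- The expected number of rounds, among the first `T`, in which action `a` is played. -/
noncomputable def expectedPulls (ρ : Policy K m) (B : UpliftingBandit K m) (T : ℕ) (a : Fin K) :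
    ℝ :=
  ∫ h, (∑ s : Fin T, if (h s).1 = a then (1 : ℝ) else 0) ∂historyLaw ρ B T

theorem measurable_pulls (T : ℕ) (a : Fin K) :
    Measurable fun h : History K m T => ∑ s, if (h s).1 = a then (1 : ℝ) else 0 :=
  measurable_history_sum (g := fun b _ => if b = a then (1 : ℝ) else 0)
    (fun _ => measurable_const) T

theorem pulls_le {T : ℕ} (h : History K m T) (a : Fin K) :
    ∑ s, (if (h s).1 = a then (1 : ℝ) else 0) ≤ T := by
  calc _ ≤ ∑ _s : Fin T, (1 : ℝ) := Finset.sum_le_sum fun s _ => by split_ifs <;> norm_num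
    _ = T := by simp

theorem pulls_nonneg {T : ℕ} (h : History K m T) (a : Fin K) :
    0 ≤ ∑ s, (if (h s).1 = a then (1 : ℝ) else 0) :=
  Finset.sum_nonneg fun s _ => by split_ifs <;> norm_num

theorem integrable_pulls (ρ : Policy K m) (B : UpliftingBandit K m) (T : ℕ) (a : Fin K) :
    Integrable (fun h : History K m T => ∑ s, if (h s).1 = a then (1 : ℝ) else 0)
      (historyLaw ρ B T) :=
  Integrable.of_bound (measurable_pulls T a).aestronglyMeasurable T <| ae_of_all _ fun h => by
    rw [Real.norm_of_nonneg (pulls_nonneg h a)]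
    exact pulls_le h a

theorem expectedPulls_nonneg (ρ : Policy K m) (B : UpliftingBandit K m) (T : ℕ) (a : Fin K) :
    0 ≤ expectedPulls ρ B T a :=
  integral_nonneg fun h => pulls_nonneg h a

theorem sum_action_eq {T : ℕ} (h : History K m T) (c : Fin K → ℝ) :
    ∑ s, c (h s).1 = ∑ a, c a * ∑ s, (if (h s).1 = a then (1 : ℝ) else 0) := by
  simp_rw [Finset.mul_sum]
  rw [Finset.sum_comm]
  simp

theorem integral_sum_action (ρ : Policy K m) (B : UpliftingBandit K m) (T : ℕ) (c : Fin K → ℝ) :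
    ∫ h, ∑ s : Fin T, c (h s).1 ∂historyLaw ρ B T = ∑ a, c a * expectedPulls ρ B T a := by
  simp_rw [sum_action_eq _ c]
  rw [integral_finsetSum _ fun a _ => (integrable_pulls ρ B T a).const_mul _]
  exact Finset.sum_congr rfl fun a _ => integral_const_mul _ _

theorem expectedRegret_eq_sum (ρ : Policy K m) (B : UpliftingBandit K m) (T : ℕ) :
    expectedRegret ρ B T = ∑ a, B.gap a * expectedPulls ρ B T a :=
  integral_sum_action ρ B T B.gap

theorem sum_pulls {T : ℕ} (h : History K m T) :
    ∑ a, ∑ s, (if (h s).1 = a then (1 : ℝ) else 0) = T := by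
  simpa using (sum_action_eq h fun _ => 1).symm

/-- Wald's identity for the sum, over the rounds, of a function of the action and the payoff
vector. -/
theorem integral_history_sum (ρ : Policy K m) (B : UpliftingBandit K m)
    {g : Fin K → (Fin m → ℝ) → ℝ} (hg : ∀ a, Measurable (g a))
    (hint : ∀ a, Integrable (g a) (B.arm a : Measure (Fin m → ℝ))) (T : ℕ) :
    Integrable (fun h => ∑ s, g (h s).1 (h s).2) (historyLaw ρ B T) ∧
      ∫ h, ∑ s, g (h s).1 (h s).2 ∂historyLaw ρ B T =
        ∑ a, (∫ x, g a x ∂(B.arm a : Measure (Fin m → ℝ))) * expectedPulls ρ B T a := by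
  rw [← integral_sum_action]
  induction T with
  | zero => simp
  | succ t ih =>
    set c : Fin K → ℝ := fun a => ∫ x, g a x ∂(B.arm a : Measure (Fin m → ℝ)) with hc
    have hgp : Measurable fun p : Fin K × (Fin m → ℝ) => g p.1 p.2 :=
      measurable_from_prod_countable_right hg
    have hinit : Measurable fun (h : History K m (t + 1)) (s : Fin t) => h (Fin.castSucc s) := by
      fun_prop
    have hlast : Measurable fun h : History K m (t + 1) => h (Fin.last t) := by fun_prop
    have hprob : IsProbabilityMeasure
        ((historyLaw ρ B (t + 1)).map (fun h => (h (Fin.last t)).1)) :=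
      Measure.isProbabilityMeasure_map (measurable_action _).aemeasurable
    have hpair : Integrable (fun p : Fin K × (Fin m → ℝ) => g p.1 p.2)
        ((historyLaw ρ B (t + 1)).map (fun h => (h (Fin.last t)).1) ⊗ₘ B.payoffKernel) := by
      rw [Measure.integrable_compProd_iff hgp.aestronglyMeasurable]
      exact ⟨ae_of_all _ hint, Integrable.of_finite⟩
    have h1 : Integrable (fun h : History K m (t + 1) =>
        ∑ s : Fin t, g (h (Fin.castSucc s)).1 (h (Fin.castSucc s)).2) (historyLaw ρ B (t + 1)) := by
      have := ih.1
      rw [← map_init_historyLaw ρ B t] at this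
      exact this.comp_measurable hinit
    have h2 : Integrable (fun h : History K m (t + 1) =>
        g (h (Fin.last t)).1 (h (Fin.last t)).2) (historyLaw ρ B (t + 1)) := by
      rw [← map_last_historyLaw] at hpair
      exact hpair.comp_measurable hlast
    have e1 : ∫ h, ∑ s : Fin t, g (h (Fin.castSucc s)).1 (h (Fin.castSucc s)).2
          ∂historyLaw ρ B (t + 1) =
        ∫ h, ∑ s : Fin t, c (h (Fin.castSucc s)).1 ∂historyLaw ρ B (t + 1) := by
      have := ih.2
      rw [← map_init_historyLaw ρ B t, integral_map hinit.aemeasurable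
          (measurable_history_sum hg t).aestronglyMeasurable, integral_map hinit.aemeasurable
          (measurable_history_sum (g := fun a _ => c a)
            (fun _ => measurable_const) t).aestronglyMeasurable] at this
      exact this
    have e2 : ∫ h, g (h (Fin.last t)).1 (h (Fin.last t)).2 ∂historyLaw ρ B (t + 1) =
        ∫ h, c (h (Fin.last t)).1 ∂historyLaw ρ B (t + 1) := by
      rw [← integral_map (φ := fun h : History K m (t + 1) => h (Fin.last t))
          (f := fun p => g p.1 p.2) hlast.aemeasurable hgp.aestronglyMeasurable,
        map_last_historyLaw, Measure.integral_compProd hpair,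
        integral_map (measurable_action _).aemeasurable
          (measurable_of_countable _).aestronglyMeasurable]
      rfl
    have hbdd : ∀ {T' : ℕ} (j : Fin T' → Fin (t + 1)), Integrable (fun h : History K m (t + 1) =>
        ∑ s : Fin T', c (h (j s)).1) (historyLaw ρ B (t + 1)) := fun j => by
      refine integrable_finsetSum _ fun s _ => ?_
      exact (Integrable.of_finite (f := c)
        (μ := (historyLaw ρ B (t + 1)).map fun h => (h (j s)).1)).comp_measurable
          (measurable_action _)
    simp_rw [Fin.sum_univ_castSucc]
    refine ⟨h1.add h2, ?_⟩
    rw [integral_add h1 h2, e1, e2, integral_add (hbdd _)]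
    simpa using hbdd (fun _ : Fin 1 => Fin.last t)

/-! ### Policies that observe only rewards -/

/-- When the decisions depend on the payoff vectors only through their sums, so does the law of
the observed actions and rewards: it is the same in two bandits whose arms have the same reward
laws. -/
theorem lintegral_historyLaw_of_rewards (hm : 0 < m) {ρ : Policy K m}
    (hρ : ∀ t (h h' : History K m t),
      (∀ s, (h s).1 = (h' s).1 ∧ ∑ i, (h s).2 i = ∑ i, (h' s).2 i) → ρ.next t h = ρ.next t h')
    {B B' : UpliftingBandit K m}
    (hB : ∀ a, (B.arm a : Measure (Fin m → ℝ)).map (fun x => ∑ i, x i) =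
      (B'.arm a : Measure (Fin m → ℝ)).map (fun x => ∑ i, x i))
    (t : ℕ) {f : (Fin t → Fin K × ℝ) → ENNReal} (hf : Measurable f) :
    ∫⁻ h, f (fun s => ((h s).1, ∑ i, (h s).2 i)) ∂historyLaw ρ B t =
      ∫⁻ h, f (fun s => ((h s).1, ∑ i, (h s).2 i)) ∂historyLaw ρ B' t := by
  induction t with
  | zero => simp [historyLaw]
  | succ t ih =>
    -- A measurable section of the map from payoff vectors to rewards.
    let lift : (Fin t → Fin K × ℝ) → History K m t := fun r s => ((r s).1, fun _ => (r s).2 / m)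
    have hlift : Measurable lift := by fun_prop
    let step (C : UpliftingBandit K m) (r : Fin t → Fin K × ℝ) : ENNReal :=
      ∑ a, ρ.next t (lift r) {a} *
        ∫⁻ y, f (Fin.snoc (α := fun _ => Fin K × ℝ) r (a, y))
          ∂(C.arm a : Measure (Fin m → ℝ)).map (fun x => ∑ i, x i)
    have hsnoc : ∀ a, Measurable fun p : (Fin t → Fin K × ℝ) × ℝ =>
        Fin.snoc (α := fun _ => Fin K × ℝ) p.1 (a, p.2) := fun a => by
      refine measurable_pi_iff.mpr fun i => Fin.lastCases ?_ (fun j => ?_) i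
      · simp only [Fin.snoc_last]
        fun_prop
      · simp only [Fin.snoc_castSucc]
        fun_prop
    have hsucc : ∀ C : UpliftingBandit K m,
        ∫⁻ h, f (fun s => ((h s).1, ∑ i, (h s).2 i)) ∂historyLaw ρ C (t + 1) =
          ∫⁻ h, step C (fun s => ((h s).1, ∑ i, (h s).2 i)) ∂historyLaw ρ C t := fun C => by
      rw [lintegral_historyLaw_succ ρ C t (by fun_prop)]
      refine lintegral_congr fun h => Finset.sum_congr rfl fun a _ => ?_
      have hfy : Measurable fun y => f (Fin.snoc (α := fun _ => Fin K × ℝ)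
          (fun s => ((h s).1, ∑ i, (h s).2 i)) (a, y)) :=
        (hf.comp (hsnoc a)).comp
          (measurable_prodMk_left (x := fun s => ((h s).1, ∑ i, (h s).2 i)))
      rw [lintegral_map hfy (by fun_prop)]
      congr 1
      · rw [hρ t h (lift fun s => ((h s).1, ∑ i, (h s).2 i)) fun s => ⟨rfl, ?_⟩]
        simp [lift, field]
      · refine lintegral_congr fun x => congrArg f ?_
        funext s
        refine Fin.lastCases ?_ (fun j => ?_) s <;> simp [History.snoc]
    have hstep : Measurable (step B') := by
      refine Finset.measurable_sum _ fun a _ => Measurable.mul ?_ ?_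
      · exact (Kernel.measurable_coe _ (measurableSet_singleton a)).comp hlift
      · have : IsProbabilityMeasure
            ((B'.arm a : Measure (Fin m → ℝ)).map fun x => ∑ i, x i) :=
          Measure.isProbabilityMeasure_map (by fun_prop)
        exact (hf.comp (hsnoc a)).lintegral_prod_right'
    have hBB' : step B = step B' := by
      funext r
      simp only [step, hB]
    rw [hsucc B, hsucc B', hBB']
    exact ih hstep

theorem expectedPulls_eq_of_rewards (hm : 0 < m) {ρ : Policy K m}
    (hρ : ∀ t (h h' : History K m t),
      (∀ s, (h s).1 = (h' s).1 ∧ ∑ i, (h s).2 i = ∑ i, (h' s).2 i) → ρ.next t h = ρ.next t h')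
    {B B' : UpliftingBandit K m}
    (hB : ∀ a, (B.arm a : Measure (Fin m → ℝ)).map (fun x => ∑ i, x i) =
      (B'.arm a : Measure (Fin m → ℝ)).map (fun x => ∑ i, x i))
    (T : ℕ) (a : Fin K) :
    expectedPulls ρ B T a = expectedPulls ρ B' T a := by
  have hmeas : Measurable fun r : Fin T → Fin K × ℝ =>
      ∑ s, if (r s).1 = a then (1 : ℝ) else 0 :=
    Finset.measurable_sum _ fun s _ => (measurable_of_countable fun b : Fin K =>
      if b = a then (1 : ℝ) else 0).comp (measurable_fst.comp (measurable_pi_apply s))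
  unfold expectedPulls
  rw [integral_eq_lintegral_of_nonneg_ae (ae_of_all _ fun h => pulls_nonneg h a)
      (measurable_pulls T a).aestronglyMeasurable,
    integral_eq_lintegral_of_nonneg_ae (ae_of_all _ fun h => pulls_nonneg h a)
      (measurable_pulls T a).aestronglyMeasurable]
  exact congrArg ENNReal.toReal (lintegral_historyLaw_of_rewards hm hρ hB T
    (f := fun r => ENNReal.ofReal (∑ s, if (r s).1 = a then (1 : ℝ) else 0)) (by fun_prop))

/-! ### Gaussian bandits with shared noise -/

/-- The law of the payoff vector with means `v` in which all variables share one standard Gaussian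
noise. -/
noncomputable def sharedNoiseLaw (v : Fin m → ℝ) : ProbabilityMeasure (Fin m → ℝ) :=
  ⟨(gaussianReal 0 1).map fun z i => z + v i, Measure.isProbabilityMeasure_map (by fun_prop)⟩

theorem coe_sharedNoiseLaw (v : Fin m → ℝ) :
    (sharedNoiseLaw v : Measure (Fin m → ℝ)) = (gaussianReal 0 1).map fun z i => z + v i :=
  rfl

theorem map_eval_sharedNoiseLaw (v : Fin m → ℝ) (i : Fin m) :
    (sharedNoiseLaw v : Measure (Fin m → ℝ)).map (fun x => x i) = gaussianReal (v i) 1 := by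
  rw [coe_sharedNoiseLaw, Measure.map_map (by fun_prop) (by fun_prop)]
  have := gaussianReal_map_add_const (μ := 0) (v := 1) (v i)
  rwa [zero_add] at this

theorem integrable_eval_sharedNoiseLaw (v : Fin m → ℝ) (i : Fin m) :
    Integrable (fun x => x i) (sharedNoiseLaw v : Measure (Fin m → ℝ)) := by
  have h : Integrable id ((sharedNoiseLaw v : Measure (Fin m → ℝ)).map fun x => x i) := by
    rw [map_eval_sharedNoiseLaw]
    exact (memLp_id_gaussianReal 1).integrable le_rfl
  exact h.comp_measurable (by fun_prop)

theorem integral_eval_sharedNoiseLaw (v : Fin m → ℝ) (i : Fin m) :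
    ∫ x, x i ∂(sharedNoiseLaw v : Measure (Fin m → ℝ)) = v i := by
  rw [← integral_map (φ := fun x : Fin m → ℝ => x i) (f := fun y => y)
    (measurable_pi_apply i).aemeasurable (by fun_prop), map_eval_sharedNoiseLaw,
    integral_id_gaussianReal]

theorem noiseSubGaussian_sharedNoiseLaw (v : Fin m → ℝ) :
    NoiseSubGaussian (sharedNoiseLaw v) := by
  intro i
  have hmap : (sharedNoiseLaw v : Measure (Fin m → ℝ)).map (fun x => x i - v i) =
      gaussianReal 0 1 := by
    rw [← sub_self (v i), ← gaussianReal_map_sub_const, ← map_eval_sharedNoiseLaw,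
      Measure.map_map (by fun_prop) (by fun_prop)]
    rfl
  rw [integral_eval_sharedNoiseLaw]
  refine ⟨fun s => ?_, fun s => ?_⟩
  · have := integrable_exp_mul_gaussianReal (μ := 0) (v := 1) s
    rw [← hmap] at this
    exact this.comp_measurable (by fun_prop)
  · rw [mgf_gaussianReal hmap]
    simp

theorem agreeOff_sharedNoiseLaw_iff (v w : Fin m → ℝ) (S : Finset (Fin m)) :
    AgreeOff (sharedNoiseLaw v) (sharedNoiseLaw w) S ↔ ∀ i, i ∉ S → v i = w i := by
  unfold AgreeOff
  constructor
  · intro h i hi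
    have h' := congrArg (fun M => ∫ y, y ⟨i, hi⟩ ∂M) h
    have hrestr : Measurable fun (x : Fin m → ℝ) (i : {i : Fin m // i ∉ S}) => x i.1 := by
      fun_prop
    rwa [integral_map hrestr.aemeasurable (measurable_pi_apply _).aestronglyMeasurable,
      integral_map hrestr.aemeasurable (measurable_pi_apply _).aestronglyMeasurable,
      integral_eval_sharedNoiseLaw, integral_eval_sharedNoiseLaw] at h'
  · intro h
    rw [coe_sharedNoiseLaw, coe_sharedNoiseLaw, Measure.map_map (by fun_prop) (by fun_prop),
      Measure.map_map (by fun_prop) (by fun_prop)]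
    congr 1
    funext z i
    simp [h i.1 i.2]

theorem map_sum_sharedNoiseLaw (v : Fin m → ℝ) :
    (sharedNoiseLaw v : Measure (Fin m → ℝ)).map (fun x => ∑ i, x i) =
      (gaussianReal 0 1).map fun z => m * z + ∑ i, v i := by
  rw [coe_sharedNoiseLaw, Measure.map_map (by fun_prop) (by fun_prop)]
  congr 1
  funext z
  simp [Finset.sum_add_distrib]

/-- The density of a translated Gaussian law with respect to the standard one. -/
theorem gaussianReal_map_add_eq_withDensity (c : ℝ) :
    (gaussianReal 0 1).map (fun z => z + c) =
      (gaussianReal 0 1).withDensity fun z => ENNReal.ofReal (Real.exp (c * z - c ^ 2 / 2)) := by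
  rw [gaussianReal_map_add_const, gaussianReal_of_var_ne_zero _ one_ne_zero,
    gaussianReal_of_var_ne_zero _ one_ne_zero,
    ← withDensity_mul _ (measurable_gaussianPDF _ _) (by fun_prop)]
  congr 1
  funext z
  rw [Pi.mul_apply, gaussianPDF, gaussianPDF,
    ← ENNReal.ofReal_mul (gaussianPDFReal_nonneg _ _ _), gaussianPDFReal, gaussianPDFReal,
    mul_assoc _ (Real.exp _), ← Real.exp_add]
  congr 3
  simp
  ring

theorem sharedNoiseLaw_add_const_eq_withDensity (v : Fin m → ℝ) (c : ℝ) (j : Fin m) :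
    (sharedNoiseLaw (fun i => v i + c) : Measure (Fin m → ℝ)) =
      (sharedNoiseLaw v : Measure (Fin m → ℝ)).withDensity fun x =>
        ENNReal.ofReal (Real.exp (c * (x j - v j) - c ^ 2 / 2)) := by
  have hcomp : (sharedNoiseLaw (fun i => v i + c) : Measure (Fin m → ℝ)) =
      ((gaussianReal 0 1).map (fun z => z + c)).map fun z i => z + v i := by
    rw [coe_sharedNoiseLaw, Measure.map_map (by fun_prop) (by fun_prop)]
    congr 1
    funext z i
    simp
    ring
  refine Measure.ext_of_lintegral _ fun f hf => ?_
  have hshift : Measurable fun (z : ℝ) (i : Fin m) => z + v i := by fun_prop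
  rw [hcomp, gaussianReal_map_add_eq_withDensity, lintegral_map hf hshift,
    lintegral_withDensity_eq_lintegral_mul _ (by fun_prop) (by fun_prop),
    lintegral_withDensity_eq_lintegral_mul _ (by fun_prop) hf, coe_sharedNoiseLaw,
    lintegral_map (by fun_prop) hshift]
  simp

theorem integral_logDensity_sharedNoiseLaw (v : Fin m → ℝ) (c : ℝ) (j : Fin m) :
    Integrable (fun x => c * (x j - v j) - c ^ 2 / 2) (sharedNoiseLaw v : Measure (Fin m → ℝ)) ∧
      ∫ x, (c * (x j - v j) - c ^ 2 / 2) ∂(sharedNoiseLaw v : Measure (Fin m → ℝ)) =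
        -(c ^ 2 / 2) := by
  have h1 := integrable_eval_sharedNoiseLaw v j
  have h2 : Integrable (fun x => c * (x j - v j)) (sharedNoiseLaw v : Measure (Fin m → ℝ)) :=
    (h1.sub (integrable_const _)).const_mul c
  refine ⟨h2.sub (integrable_const _), ?_⟩
  rw [integral_sub h2 (integrable_const _), integral_const_mul,
    integral_sub h1 (integrable_const _), integral_eval_sharedNoiseLaw]
  simp

/-- The uplifting bandit in which all variables share one standard Gaussian noise, with baseline
means zero and with means `v a` under action `a`; an action affects the variables to which it gives
a nonzero mean. -/
noncomputable def sharedNoiseBandit (v : Fin K → Fin m → ℝ) : UpliftingBandit K m where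
  baseline := sharedNoiseLaw 0
  arm a := sharedNoiseLaw (v a)
  affected a := {i | v a i ≠ 0}
  affected_minimal a := by
    refine ⟨?_, fun S hS _ i hi => ?_⟩
    · rw [agreeOff_sharedNoiseLaw_iff]
      simp
    · rw [agreeOff_sharedNoiseLaw_iff] at hS
      by_contra hiS
      exact (Finset.mem_filter.mp hi).2 (hS i hiS)

theorem isSubGaussian_sharedNoiseBandit (v : Fin K → Fin m → ℝ) :
    (sharedNoiseBandit v).IsSubGaussian :=
  ⟨noiseSubGaussian_sharedNoiseLaw _, fun _ => noiseSubGaussian_sharedNoiseLaw _⟩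

theorem gap_sharedNoiseBandit {v : Fin K → Fin m → ℝ} {r : ℝ} {d : Fin K → ℝ}
    (hv : ∀ a, ∑ i, v a i = r - d a) (hd : ∀ a, 0 ≤ d a) {b : Fin K} (hb : d b = 0) (a : Fin K) :
    (sharedNoiseBandit v).gap a = d a := by
  have hmean : ∀ a, (sharedNoiseBandit v).meanReward a = r - d a := fun a => by
    rw [← hv, UpliftingBandit.meanReward]
    exact Finset.sum_congr rfl fun i _ => integral_eval_sharedNoiseLaw _ _
  have : Nonempty (Fin K) := ⟨b⟩
  have hsup : ⨆ b, (sharedNoiseBandit v).meanReward b = r := by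
    simp_rw [hmean]
    refine le_antisymm (ciSup_le fun a => by linarith [hd a]) ?_
    exact (by rw [hb, sub_zero] : r = r - d b).trans_le
      (le_ciSup (f := fun a => r - d a) (Set.finite_range _).bddAbove b)
  rw [UpliftingBandit.gap, hsup, hmean, sub_sub_cancel]

/-! ### The lower bound on the number of pulls -/

/-- A Bretagnolle–Huber inequality: two laws with log-likelihood ratio `l` cannot be told apart
with error probabilities whose sum is below `exp (E[l] - 1)`, where `-E[l]` is the relative
entropy. -/
theorem exp_integral_sub_one_le {Ω : Type*} [MeasurableSpace Ω] {μ ν : Measure Ω}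
    [IsProbabilityMeasure μ] [IsProbabilityMeasure ν] {l : Ω → ℝ} (hl : Measurable l)
    (hint : Integrable l μ) (hν : ν = μ.withDensity fun x => ENNReal.ofReal (Real.exp (l x)))
    {A : Set Ω} (hA : MeasurableSet A) :
    Real.exp (∫ x, l x ∂μ - 1) ≤ μ.real A + ν.real Aᶜ := by
  have hmass : ∫⁻ x, ENNReal.ofReal (Real.exp (l x)) ∂μ = 1 := by
    rw [← setLIntegral_univ, ← withDensity_apply _ MeasurableSet.univ, ← hν, measure_univ]
  have hexp : Integrable (fun x => Real.exp (l x)) μ := by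
    refine ⟨by fun_prop, ?_⟩
    rw [hasFiniteIntegral_iff_ofReal (ae_of_all _ fun x => Real.exp_nonneg _), hmass]
    exact ENNReal.one_lt_top
  have hexp1 : ∫ x, Real.exp (l x) ∂μ = 1 := by
    rw [integral_eq_lintegral_of_nonneg_ae (ae_of_all _ fun x => Real.exp_nonneg _)
      (by fun_prop), hmass, ENNReal.toReal_one]
  have hνA : ν.real Aᶜ = ∫ x in Aᶜ, Real.exp (l x) ∂μ := by
    rw [measureReal_def, hν, withDensity_apply _ hA.compl,
      integral_eq_lintegral_of_nonneg_ae (ae_of_all _ fun x => Real.exp_nonneg _) (by fun_prop)]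
  set y := ∫ x, l x ∂μ - 1 with hy
  -- Both `1` and `exp l` exceed `exp u` with `u = l - exp l`, which exceeds its tangent at `y`.
  let tangent : Ω → ℝ := fun x => Real.exp y * (1 - y + (l x - Real.exp (l x)))
  have htan : ∀ x, tangent x ≤ Real.exp (l x - Real.exp (l x)) := fun x => by
    have := Real.add_one_le_exp (l x - Real.exp (l x) - y)
    calc tangent x ≤ Real.exp y * Real.exp (l x - Real.exp (l x) - y) :=
          mul_le_mul_of_nonneg_left (by linarith) (Real.exp_nonneg _)
      _ = _ := by rw [← Real.exp_add]; ring_nf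
  have htanint : Integrable tangent μ :=
    ((integrable_const _).add (hint.sub hexp)).const_mul _
  have htanval : ∫ x, tangent x ∂μ = Real.exp y := by
    have hdiff : Integrable (fun x => l x - Real.exp (l x)) μ := hint.sub hexp
    have : ∫ x, (1 - y + (l x - Real.exp (l x))) ∂μ = 1 := by
      rw [integral_add (integrable_const _) hdiff, integral_sub hint hexp, hexp1]
      simp [hy]
    simp only [tangent]
    rw [integral_const_mul, this, mul_one]
  have h1 : ∫ x in A, tangent x ∂μ ≤ μ.real A := by
    have : ∫ _x in A, (1 : ℝ) ∂μ = μ.real A := by simp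
    rw [← this]
    refine integral_mono htanint.integrableOn (integrable_const _) fun x => (htan x).trans ?_
    exact Real.exp_le_one_iff.mpr (by linarith [Real.add_one_le_exp (l x)])
  have h2 : ∫ x in Aᶜ, tangent x ∂μ ≤ ν.real Aᶜ := by
    rw [hνA]
    refine integral_mono htanint.integrableOn hexp.integrableOn fun x => (htan x).trans ?_
    exact Real.exp_le_exp.mpr (by linarith [Real.exp_nonneg (l x)])
  rw [← htanval, ← integral_add_compl hA htanint]
  exact add_le_add h1 h2

theorem historyLaw_eq_withDensity (ρ : Policy K m) {B B' : UpliftingBandit K m}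
    {g : Fin K → (Fin m → ℝ) → ℝ} (hg : ∀ a, Measurable (g a))
    (hB : ∀ a, (B'.arm a : Measure (Fin m → ℝ)) =
      (B.arm a : Measure (Fin m → ℝ)).withDensity fun x => ENNReal.ofReal (Real.exp (g a x)))
    (T : ℕ) :
    historyLaw ρ B' T = (historyLaw ρ B T).withDensity fun h =>
      ENNReal.ofReal (Real.exp (∑ s, g (h s).1 (h s).2)) := by
  have := measurable_history_sum hg T
  refine Measure.ext_of_lintegral _ fun f hf => ?_
  rw [lintegral_historyLaw_of_withDensity ρ hg hB T hf,
    lintegral_withDensity_eq_lintegral_mul _ (by fun_prop) hf]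
  rfl

/-- If `B'` differs from `B` only in the law of the arm `a`, by a relative entropy `D`, then a
policy that pulls `a` rarely in `B`, or pulls the other arms rarely in `B'`, must pull `a` often
enough in `B` to tell the two apart. -/
theorem exp_neg_mul_expectedPulls_le (ρ : Policy K m) {B B' : UpliftingBandit K m} {a : Fin K}
    {l : (Fin m → ℝ) → ℝ} {D : ℝ} (hl : Measurable l)
    (hint : Integrable l (B.arm a : Measure (Fin m → ℝ)))
    (hD : ∫ x, l x ∂(B.arm a : Measure (Fin m → ℝ)) = -D)
    (ha : (B'.arm a : Measure (Fin m → ℝ)) =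
      (B.arm a : Measure (Fin m → ℝ)).withDensity fun x => ENNReal.ofReal (Real.exp (l x)))
    (hne : ∀ b, b ≠ a → B'.arm b = B.arm b) (T : ℕ) :
    Real.exp (-(D * expectedPulls ρ B T a) - 1) * (T / 2) ≤
      expectedPulls ρ B T a + ∑ b with b ≠ a, expectedPulls ρ B' T b := by
  let g : Fin K → (Fin m → ℝ) → ℝ := fun b => if b = a then l else 0
  have hg : ∀ b, Measurable (g b) := fun b => by
    by_cases hb : b = a
    · simpa [g, hb] using hl
    · simpa [g, hb] using measurable_zero
  have hgint : ∀ b, Integrable (g b) (B.arm b : Measure (Fin m → ℝ)) := fun b => by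
    by_cases hb : b = a
    · subst hb
      simpa [g] using hint
    · simp [g, hb]
  have hB : ∀ b, (B'.arm b : Measure (Fin m → ℝ)) =
      (B.arm b : Measure (Fin m → ℝ)).withDensity fun x =>
        ENNReal.ofReal (Real.exp (g b x)) := fun b => by
    by_cases hb : b = a
    · subst hb
      simpa [g] using ha
    · simp [g, hb, hne b hb]
  obtain ⟨hsum, hwald⟩ := integral_history_sum ρ B hg hgint T
  rw [Finset.sum_eq_single a (fun b _ hb => by simp [g, hb]) (by simp)] at hwald
  simp only [g, if_true, hD] at hwald
  set pulls : History K m T → ℝ := fun h => ∑ s, if (h s).1 = a then (1 : ℝ) else 0 with hpulls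
  have hpm : Measurable pulls := measurable_pulls T a
  let A : Set (History K m T) := {h | (T : ℝ) / 2 ≤ pulls h}
  have hA : MeasurableSet A := measurableSet_le measurable_const hpm
  have key := exp_integral_sub_one_le (measurable_history_sum hg T) hsum
    (historyLaw_eq_withDensity ρ hg hB T) hA
  rw [hwald, neg_mul] at key
  have h1 : (historyLaw ρ B T).real A * (T / 2) ≤ expectedPulls ρ B T a := by
    have := mul_meas_ge_le_integral_of_nonneg (ae_of_all _ fun h => pulls_nonneg h a)
      (integrable_pulls ρ B T a) ((T : ℝ) / 2)
    rw [mul_comm]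
    exact this
  have hcompl : ∑ b with b ≠ a, expectedPulls ρ B' T b = ∫ h, (T - pulls h) ∂historyLaw ρ B' T := by
    simp only [expectedPulls]
    rw [← integral_finsetSum _ fun b _ => integrable_pulls ρ B' T b]
    refine integral_congr_ae (ae_of_all _ fun h => ?_)
    simp only [hpulls]
    rw [← sum_pulls h, ← Finset.sum_erase_eq_sub (Finset.mem_univ a)]
    exact Finset.sum_congr (by ext; simp) fun _ _ => rfl
  have h2 : (historyLaw ρ B' T).real Aᶜ * (T / 2) ≤ ∑ b with b ≠ a, expectedPulls ρ B' T b := by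
    rw [hcompl, mul_comm]
    refine le_trans ?_ (mul_meas_ge_le_integral_of_nonneg
      (ae_of_all _ fun h => sub_nonneg.mpr (pulls_le h a))
      ((integrable_const _).sub (integrable_pulls ρ B' T a)) ((T : ℝ) / 2))
    refine mul_le_mul_of_nonneg_left (measureReal_mono fun h hh => ?_) (by positivity)
    have hlt : pulls h < T / 2 := not_le.mp hh
    change (T : ℝ) / 2 ≤ T - pulls h
    linarith
  have hT : (0 : ℝ) ≤ T / 2 := by positivity
  calc _ ≤ ((historyLaw ρ B T).real A + (historyLaw ρ B' T).real Aᶜ) * (T / 2) :=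
        mul_le_mul_of_nonneg_right key hT
    _ ≤ _ := by rw [add_mul]; exact add_le_add h1 h2

theorem gap_mul_expectedPulls_le_expectedRegret (ρ : Policy K m) {B : UpliftingBandit K m}
    (hB : ∀ a, 0 ≤ B.gap a) (T : ℕ) (S : Finset (Fin K)) :
    ∑ a ∈ S, B.gap a * expectedPulls ρ B T a ≤ expectedRegret ρ B T := by
  rw [expectedRegret_eq_sum]
  exact Finset.sum_le_sum_of_subset_of_nonneg (Finset.subset_univ S)
    fun b _ _ => mul_nonneg (hB b) (expectedPulls_nonneg ρ B T b)

theorem eventually_le_mul_of_exp_le {D : ℝ} {N u : ℕ → ℝ} {p : ℝ} (hp : 0 < p)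
    (hN : ∀ T : ℕ, Real.exp (-(D * N T) - 1) * (T / 2) ≤ u T)
    (hu : u =o[atTop] fun T : ℕ => (T : ℝ) ^ p) :
    ∀ᶠ T : ℕ in atTop, (1 - 2 * p) * Real.log T ≤ D * N T := by
  have hlog : Tendsto (fun T : ℕ => Real.log T) atTop atTop :=
    Real.tendsto_log_atTop.comp tendsto_natCast_atTop_atTop
  filter_upwards [hu.bound one_pos, hlog.eventually_ge_atTop ((1 + Real.log 2) / p),
    eventually_gt_atTop 0] with T hT hTlog hT0
  have hT0' : (0 : ℝ) < T := by exact_mod_cast hT0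
  rw [one_mul, Real.norm_of_nonneg (Real.rpow_nonneg hT0'.le p)] at hT
  have h := Real.log_le_log (by positivity) ((hN T).trans ((le_abs_self _).trans hT))
  rw [Real.log_mul (Real.exp_ne_zero _) (by positivity), Real.log_exp,
    Real.log_div hT0'.ne' two_ne_zero, Real.log_rpow hT0'] at h
  rw [div_le_iff₀ hp] at hTlog
  linarith

/-- The asymptotic lower bound of Lai and Robbins on the number of pulls of a suboptimal arm `a`,
from an alternative bandit in which `a` has become the only optimal arm. -/
theorem eventually_log_le_mul_expectedPulls (ρ : Policy K m) {B B' : UpliftingBandit K m}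
    {a : Fin K} {l : (Fin m → ℝ) → ℝ} {D ε p : ℝ} (hl : Measurable l)
    (hint : Integrable l (B.arm a : Measure (Fin m → ℝ)))
    (hD : ∫ x, l x ∂(B.arm a : Measure (Fin m → ℝ)) = -D)
    (ha : (B'.arm a : Measure (Fin m → ℝ)) =
      (B.arm a : Measure (Fin m → ℝ)).withDensity fun x => ENNReal.ofReal (Real.exp (l x)))
    (hne : ∀ b, b ≠ a → B'.arm b = B.arm b)
    (hgap : ∀ b, 0 ≤ B.gap b) (hgap' : ∀ b, 0 ≤ B'.gap b) (hgapa : 0 < B.gap a) (hε : 0 < ε)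
    (hgapε : ∀ b, b ≠ a → ε ≤ B'.gap b) (hp : 0 < p)
    (hR : (fun T : ℕ => expectedRegret ρ B T) =o[atTop] fun T : ℕ => (T : ℝ) ^ p)
    (hR' : (fun T : ℕ => expectedRegret ρ B' T) =o[atTop] fun T : ℕ => (T : ℝ) ^ p) :
    ∀ᶠ T : ℕ in atTop, (1 - 2 * p) * Real.log T ≤ D * expectedPulls ρ B T a := by
  refine eventually_le_mul_of_exp_le hp (fun T => ?_)
    ((hR.const_mul_left (B.gap a)⁻¹).add (hR'.const_mul_left ε⁻¹))
  refine (exp_neg_mul_expectedPulls_le ρ hl hint hD ha hne T).trans (add_le_add ?_ ?_)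
  · rw [inv_mul_eq_div, le_div_iff₀ hgapa, mul_comm]
    simpa using gap_mul_expectedPulls_le_expectedRegret ρ hgap T {a}
  · rw [inv_mul_eq_div, le_div_iff₀ hε, mul_comm, Finset.mul_sum]
    refine le_trans (Finset.sum_le_sum fun b hb => ?_)
      (gap_mul_expectedPulls_le_expectedRegret ρ hgap' T {b | b ≠ a})
    exact mul_le_mul_of_nonneg_right (hgapε b (by simpa using hb)) (expectedPulls_nonneg ρ B' T b)

/-! ### The hard instances -/

/-- The means that split the expected reward `w a` of every action `a` evenly among the variables
in `V a`. -/
noncomputable def evenMeans (V : Fin K → Finset (Fin m)) (w : Fin K → ℝ) (a : Fin K) (i : Fin m) :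
    ℝ :=
  if i ∈ V a then w a / (V a).card else 0

theorem sum_evenMeans {V : Fin K → Finset (Fin m)} (hV : ∀ a, (V a).Nonempty) (w : Fin K → ℝ)
    (a : Fin K) : ∑ i, evenMeans V w a i = w a := by
  have : ((V a).card : ℝ) ≠ 0 := by exact_mod_cast (hV a).card_ne_zero
  simp [evenMeans, field]

theorem affected_evenMeans {V : Fin K → Finset (Fin m)} (hV : ∀ a, (V a).Nonempty)
    {w : Fin K → ℝ} (hw : ∀ a, 0 < w a) : (sharedNoiseBandit (evenMeans V w)).affected = V := by
  funext a
  ext i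
  have := (hV a).card_ne_zero
  simpa [sharedNoiseBandit, evenMeans, (hw a).ne'] using fun _ => (hV a).ne_empty

/-- The means `v`, with the mean of every variable raised by `c` under action `a`. -/
def raisedMeans (v : Fin K → Fin m → ℝ) (a : Fin K) (c : ℝ) (b : Fin K) (i : Fin m) : ℝ :=
  if b = a then v b i + c else v b i

theorem sum_raisedMeans (v : Fin K → Fin m → ℝ) (a : Fin K) (c : ℝ) (b : Fin K) :
    ∑ i, raisedMeans v a c b i = ∑ i, v b i + if b = a then m * c else 0 := by
  unfold raisedMeans
  split_ifs <;> simp [Finset.sum_add_distrib]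

/-- An algorithm that is told the affected sets `V` has small regret on the bandit with raised
means, although these means may enlarge the affected set of `a`. Either the affected set does not
change, or the algorithm does not look at it, or the algorithm sees only rewards and cannot
distinguish the raised bandit from one with the same expected rewards and affected sets `V`. -/
theorem isLittleO_expectedRegret_raisedMeans (hm : 0 < m) {π : Algorithm K m} (hπ : π.Consistent)
    {V : Fin K → Finset (Fin m)} (hV : ∀ a, (V a).Nonempty)
    (hcases : (∀ a, V a = Finset.univ) ∨ π.UsesOnlyRewards ∨ π.IgnoresAffected)
    {w d : Fin K → ℝ} {r c : ℝ} (hw : ∀ a, 0 < w a) (hc : 0 < c) {a : Fin K} (hda : d a = 0)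
    (hd : ∀ b, 0 ≤ d b)
    (hsum : ∀ b, ∑ i, raisedMeans (evenMeans V w) a c b i = r - d b) {p : ℝ} (hp : 0 < p) :
    (fun T : ℕ => expectedRegret (π (sharedNoiseLaw 0) V)
      (sharedNoiseBandit (raisedMeans (evenMeans V w) a c)) T) =o[atTop]
      fun T : ℕ => (T : ℝ) ^ p := by
  set v := raisedMeans (evenMeans V w) a c with hv
  have hreg := hπ (sharedNoiseBandit v) (isSubGaussian_sharedNoiseBandit v) p hp
  rcases hcases with hfull | hrew | hign
  · have haff : (sharedNoiseBandit v).affected = V := by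
      funext b
      rw [hfull b]
      ext i
      have h0 : 0 < evenMeans V w b i := by
        have := Finset.card_pos.mpr (hV b)
        have := hw b
        have hi : i ∈ V b := by simp [hfull b]
        rw [evenMeans, if_pos hi]
        positivity
      have hne : v b i ≠ 0 := by
        simp only [hv, raisedMeans]
        split_ifs <;> positivity
      simpa [sharedNoiseBandit] using hne
    simp only [Algorithm.regret, haff] at hreg
    exact hreg
  · have hw' : ∀ b, 0 < r - d b := fun b => by
      rw [← hsum b, hv, sum_raisedMeans, sum_evenMeans hV]
      have := hw b
      split_ifs <;> positivity
    set v' := evenMeans V fun b => r - d b with hv'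
    have hsum' : ∀ b, ∑ i, v' b i = r - d b := sum_evenMeans hV _
    have hreg' := hπ (sharedNoiseBandit v') (isSubGaussian_sharedNoiseBandit v') p hp
    simp only [Algorithm.regret, hv', affected_evenMeans hV hw'] at hreg'
    refine hreg'.congr_left fun T => ?_
    rw [expectedRegret_eq_sum, expectedRegret_eq_sum]
    refine Finset.sum_congr rfl fun b _ => ?_
    rw [gap_sharedNoiseBandit hsum hd hda, gap_sharedNoiseBandit hsum' hd hda]
    congr 1
    refine expectedPulls_eq_of_rewards hm (hrew _ V) (fun b => ?_) T b
    refine (map_sum_sharedNoiseLaw (v' b)).trans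
      (Eq.trans ?_ (map_sum_sharedNoiseLaw (v b)).symm)
    rw [hsum, hsum']
  · rw [hign (sharedNoiseLaw 0) V (sharedNoiseBandit v).affected]
    exact hreg

/-- The lower bound on the contribution of one suboptimal action to the regret, with an arbitrarily small loss. -/
theorem eventually_le_gap_mul_expectedPulls (hm : 0 < m) {π : Algorithm K m} (hπ : π.Consistent)
    {V : Fin K → Finset (Fin m)} (hV : ∀ a, (V a).Nonempty)
    (hcases : (∀ a, V a = Finset.univ) ∨ π.UsesOnlyRewards ∨ π.IgnoresAffected)
    {r : ℝ} {Δ : Fin K → ℝ} (hr : ∀ a, 0 < r - Δ a) (hΔ : ∀ a, 0 ≤ Δ a) {b₀ : Fin K}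
    (hb₀ : Δ b₀ = 0) {a : Fin K} (ha : 0 < Δ a) {η : ℝ} (hη : 0 < η) :
    ∀ᶠ T : ℕ in atTop, (1 - η) * (2 * m ^ 2 / Δ a) * Real.log T ≤
      Δ a * expectedPulls (π (sharedNoiseLaw 0) V)
        (sharedNoiseBandit (evenMeans V fun b => r - Δ b)) T a := by
  -- The alternative bandit makes `a` optimal by a margin `ε`, with the same shift `c` of all
  -- variables: since they share their noise, its relative entropy is `c ^ 2 / 2`.
  set ε := Δ a * (η / 8) with hε
  have hεpos : 0 < ε := by positivity
  set c := (Δ a + ε) / m with hc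
  have hmpos : (0 : ℝ) < m := by exact_mod_cast hm
  have hcpos : 0 < c := by positivity
  set v := evenMeans V fun b => r - Δ b with hv
  set ρ := π (sharedNoiseLaw 0) V with hρ
  have hsum : ∀ b, ∑ i, v b i = r - Δ b := sum_evenMeans hV _
  let d : Fin K → ℝ := fun b => if b = a then 0 else Δ b + ε
  have hd : ∀ b, 0 ≤ d b := fun b => by
    have := hΔ b
    simp only [d]
    split_ifs <;> positivity
  have hda : d a = 0 := by simp [d]
  have hsum' : ∀ b, ∑ i, raisedMeans v a c b i = r + ε - d b := fun b => by
    rw [sum_raisedMeans, hsum]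
    simp only [d]
    split_ifs with hb
    · subst hb
      rw [hc]
      field_simp
      ring
    · ring
  have hgap : ∀ b, (sharedNoiseBandit v).gap b = Δ b := gap_sharedNoiseBandit hsum hΔ hb₀
  have hgap' : ∀ b, (sharedNoiseBandit (raisedMeans v a c)).gap b = d b :=
    gap_sharedNoiseBandit hsum' hd hda
  have hη4 : 0 < η / 4 := by positivity
  have hR : (fun T : ℕ => expectedRegret ρ (sharedNoiseBandit v) T) =o[atTop]
      fun T : ℕ => (T : ℝ) ^ (η / 4) := by
    have := hπ (sharedNoiseBandit v) (isSubGaussian_sharedNoiseBandit v) _ hη4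
    simp only [Algorithm.regret, hv, affected_evenMeans hV hr] at this
    exact this
  have hR' := isLittleO_expectedRegret_raisedMeans hm hπ hV hcases hr hcpos hda hd hsum' hη4
  have hraise : ((sharedNoiseBandit (raisedMeans v a c)).arm a : Measure (Fin m → ℝ)) =
      ((sharedNoiseBandit v).arm a : Measure (Fin m → ℝ)).withDensity fun x =>
        ENNReal.ofReal (Real.exp (c * (x ⟨0, hm⟩ - v a ⟨0, hm⟩) - c ^ 2 / 2)) := by
    have : raisedMeans v a c a = fun i => v a i + c := by
      funext i
      simp [raisedMeans]
    change (sharedNoiseLaw (raisedMeans v a c a) : Measure (Fin m → ℝ)) = _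
    rw [this]
    exact sharedNoiseLaw_add_const_eq_withDensity (v a) c ⟨0, hm⟩
  have hne : ∀ b, b ≠ a →
      (sharedNoiseBandit (raisedMeans v a c)).arm b = (sharedNoiseBandit v).arm b := fun b hb => by
    have : raisedMeans v a c b = v b := by
      funext i
      simp [raisedMeans, hb]
    simp [sharedNoiseBandit, this]
  obtain ⟨hint, hD⟩ := integral_logDensity_sharedNoiseLaw (v a) c ⟨0, hm⟩
  have key := eventually_log_le_mul_expectedPulls ρ (B := sharedNoiseBandit v) (by fun_prop) hint
    hD hraise hne (fun b => (hgap b).symm ▸ hΔ b) (fun b => (hgap' b).symm ▸ hd b)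
    ((hgap a).symm ▸ ha) hεpos (fun b hb => by
      rw [hgap']
      simp only [d, if_neg hb]
      linarith [hΔ b]) hη4 hR hR'
  filter_upwards [key, eventually_ge_atTop 1] with T hT hT1
  have hlog : 0 ≤ Real.log T := Real.log_nonneg (by exact_mod_cast hT1)
  set N := expectedPulls ρ (sharedNoiseBandit v) T a
  have hcval : c ^ 2 / 2 = Δ a ^ 2 * (1 + η / 8) ^ 2 / (2 * m ^ 2) := by
    rw [hc, hε]
    field_simp
  rw [hcval, div_mul_eq_mul_div, le_div_iff₀ (by positivity)] at hT
  -- The exponent `η / 4` and the margin `ε` are chosen so that their joint loss is at most `η`.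
  have hloss : (1 - η) * (1 + η / 8) ^ 2 ≤ 1 - 2 * (η / 4) := by
    nlinarith [mul_pos hη hη, mul_pos (mul_pos hη hη) hη]
  have h3 := mul_le_mul_of_nonneg_right hloss (mul_nonneg hlog (by positivity : (0:ℝ) ≤ 2 * m ^ 2))
  have hpos : 0 < (1 + η / 8) ^ 2 := by positivity
  rw [mul_div_assoc', div_mul_eq_mul_div, div_le_iff₀ ha]
  refine le_of_mul_le_mul_left ?_ hpos
  linarith

end Uplift

open Uplift

theorem mainTheorem3 (K m : ℕ) (hK : 0 < K) (hm : 0 < m)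
    (π : Uplift.Algorithm K m) (hπ : π.Consistent)
    (L : Fin K → ℕ) (Δ : Fin K → ℝ)
    (hL : ∀ a, 1 ≤ L a ∧ L a ≤ m) (hΔ : ∀ a, 0 ≤ Δ a) (hΔ₁ : Δ ⟨0, hK⟩ = 0)
    (hcases : (∀ a, L a = m) ∨ π.UsesOnlyRewards ∨ π.IgnoresAffected) :
    ∃ B : Uplift.UpliftingBandit K m, B.IsSubGaussian ∧
      (∀ a, B.gap a = Δ a) ∧ (∀ a, (B.affected a).card = L a) ∧
      ((∑ a with 0 < Δ a, 2 * (m : ℝ) ^ 2 / Δ a : ℝ) : EReal) ≤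
        liminf (fun T : ℕ => ((π.regret B T / Real.log T : ℝ) : EReal)) atTop := by
  have hsets : ∀ a, ∃ S : Finset (Fin m), S.card = L a := fun a => by
    obtain ⟨S, -, hS⟩ := Finset.exists_subset_card_eq
      (s := (Finset.univ : Finset (Fin m))) (n := L a) (by simpa using (hL a).2)
    exact ⟨S, hS⟩
  choose V hVcard using hsets
  have hV : ∀ a, (V a).Nonempty := fun a =>
    Finset.card_pos.mp (by rw [hVcard]; exact (hL a).1)
  have hcasesV : (∀ a, V a = Finset.univ) ∨ π.UsesOnlyRewards ∨ π.IgnoresAffected :=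
    hcases.imp_left fun h a => by
      rw [← Finset.card_eq_iff_eq_univ, hVcard, h, Fintype.card_fin]
  -- The reward of the optimal actions is large enough for all expected rewards to be positive.
  set r : ℝ := 1 + ∑ a, Δ a with hr
  have hpos : ∀ a, 0 < r - Δ a := fun a => by
    have := Finset.single_le_sum (fun b _ => hΔ b) (Finset.mem_univ a)
    linarith
  set v := evenMeans V fun a => r - Δ a with hv
  have haff : (sharedNoiseBandit v).affected = V := affected_evenMeans hV hpos
  have hgap : ∀ a, (sharedNoiseBandit v).gap a = Δ a :=
    gap_sharedNoiseBandit (sum_evenMeans hV _) hΔ hΔ₁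
  refine ⟨sharedNoiseBandit v, isSubGaussian_sharedNoiseBandit v, hgap,
    fun a => by rw [haff, hVcard], ?_⟩
  set S : ℝ := ∑ a with 0 < Δ a, 2 * (m : ℝ) ^ 2 / Δ a with hS
  have hη : ∀ η : ℝ, 0 < η → (((1 - η) * S : ℝ) : EReal) ≤
      liminf (fun T : ℕ => ((π.regret (sharedNoiseBandit v) T / Real.log T : ℝ) : EReal))
        atTop := fun η hη0 => by
    have hall := (eventually_all_finset {a | 0 < Δ a}).mpr fun a ha =>
      eventually_le_gap_mul_expectedPulls hm hπ hV hcasesV hpos hΔ hΔ₁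
        (Finset.mem_filter.mp ha).2 hη0
    refine le_liminf_of_le (by isBoundedDefault) ?_
    filter_upwards [hall, eventually_ge_atTop 2] with T hT hT2
    have hlog : 0 < Real.log T := Real.log_pos (by exact_mod_cast hT2)
    rw [EReal.coe_le_coe_iff, le_div_iff₀ hlog, hS, Finset.mul_sum, Finset.sum_mul]
    have hreg : π.regret (sharedNoiseBandit v) T =
        expectedRegret (π (sharedNoiseLaw 0) V) (sharedNoiseBandit v) T := by
      rw [Algorithm.regret, haff]
      rfl
    rw [hreg]
    refine (Finset.sum_le_sum hT).trans ?_
    have := gap_mul_expectedPulls_le_expectedRegret (π (sharedNoiseLaw 0) V)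
      (fun a => (hgap a).symm ▸ hΔ a) T {a | 0 < Δ a}
    simpa only [hgap] using this
  have hlim : Tendsto (fun η : ℝ => (((1 - η) * S : ℝ) : EReal)) (nhdsWithin 0 (Set.Ioi 0))
      (nhds (S : EReal)) := by
    have : Continuous fun η : ℝ => (((1 - η) * S : ℝ) : EReal) :=
      continuous_coe_real_ereal.comp (by fun_prop)
    have h0 := this.tendsto 0
    rw [sub_zero, one_mul] at h0
    exact h0.mono_left nhdsWithin_le_nhds
  refine le_of_tendsto hlim ?_
  filter_upwards [self_mem_nhdsWithin] with η using hη η
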